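/- A bi-invariant metric on a group $G$ is a metric $d$ with $d(gx,gy)=d(x,y)=d(xg,yg)$ for all $g,x,y\in G$; it is called discrete if it induces the discrete topology. A metric group $(H,d_H)$ embeds isometrically into $(G,d_G)$ if there is an isometric group homomorphism $H\to G$, i.e. if $H$ is isometrically isomorphic to a subgroup of $G$. For bi-invariant metrics $d,p$ on the free group $F_3$ of rank $3$ let $$\mathrm{dist}(d,p)=\inf\{\varepsilon>0:\ |d(g,1)-p(g,1)|\le\varepsilon\,|g|\ \text{for all } g\in F_3\},$$ where $|g|$ is the word length of $g$ with respect to the free generators. Theorem. 1. There are a constant $K>0$ and a set of cardinality continuum of discrete bi-invariant metrics on $F_3$ such that $\mathrm{dist}(d,p)>K$ for any two distinct metrics $d,p$ in it. 2. For every separable group $(G,d_G)$ with bi-invariant metric there is a locally compact separable group $(H,d_H)$ with bi-invariant metric that does not embed isometrically into $(G,d_G)$; one can take $H=F_3$ with a discrete bi-invariant metric $d_H$. 3. Hence there is no separable group with bi-invariant metric into which every separable group with bi-invariant metric embeds isometrically, and there is no locally compact separable group with bi-invariant metric into which every locally compact separable group with bi-invariant metric embeds isometrically. -/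

import Mathlib

universe u v

/-- A bi-invariant metric on a group `G`, given by its distance function. -/
structure BiInvariantMetric (G : Type u) [Group G] where
  toFun : G → G → ℝ
  self_eq_zero : ∀ x, toFun x x = 0
  comm : ∀ x y, toFun x y = toFun y x
  triangle : ∀ x y z, toFun x z ≤ toFun x y + toFun y z
  eq_of_eq_zero : ∀ x y, toFun x y = 0 → x = y
  mul_left : ∀ g x y, toFun (g * x) (g * y) = toFun x y
  mul_right : ∀ g x y, toFun (x * g) (y * g) = toFun x y

/-- The group `G` equipped with the bi-invariant metric `d`, that is, the metric group `(G, d)`. -/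
def WithBiInvariantMetric {G : Type u} [Group G] (_d : BiInvariantMetric G) : Type u := G

namespace WithBiInvariantMetric

variable {G : Type u} [Group G] (d : BiInvariantMetric G)

instance : Group (WithBiInvariantMetric d) := inferInstanceAs (Group G)

noncomputable instance : MetricSpace (WithBiInvariantMetric d) where
  dist := d.toFun
  dist_self := d.self_eq_zero
  dist_comm := d.comm
  dist_triangle := d.triangle
  eq_of_dist_eq_zero := d.eq_of_eq_zero _ _

instance : IsIsometricSMul (WithBiInvariantMetric d) (WithBiInvariantMetric d) :=
  ⟨fun g => Isometry.of_dist_eq fun x y => d.mul_left g x y⟩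

instance : IsIsometricSMul (WithBiInvariantMetric d)ᵐᵒᵖ (WithBiInvariantMetric d) :=
  ⟨fun g => Isometry.of_dist_eq fun x y => d.mul_right g.unop x y⟩

end WithBiInvariantMetric

/-- The distance of two bi-invariant metrics `d`, `p` on the free group `F_n`: the infimum of all
`ε > 0` with `|d(g,1) - p(g,1)| ≤ ε |g|` for all `g`, where `|g|` is the length of the reduced
word of `g`. -/
noncomputable def BiInvariantMetric.freeDist {n : ℕ}
    (d p : BiInvariantMetric (FreeGroup (Fin n))) : ℝ :=
  sInf {ε : ℝ | 0 < ε ∧ ∀ g : FreeGroup (Fin n), |d.toFun g 1 - p.toFun g 1| ≤ ε * (g.norm : ℝ)}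

/-- `H` is isometrically isomorphic to a subgroup of `G`. -/
def EmbedsIsometrically (H : Type v) (G : Type u) [Group H] [MetricSpace H]
    [Group G] [MetricSpace G] : Prop :=
  ∃ f : H →* G, Isometry f

/-! A free group carries uncountably many bi-invariant metrics that are far apart at the scale of
word length. Let `quaternionHom n` send two generators to rotations by an angle of order `16 ^ (-n)`
about orthogonal axes. Scaled by `16 ^ n`, the pulled-back distance to `1` is at most `2 |g|` for
every `n`, so suprema over any `A ⊆ ℕ` are finite; adding the 0-1 metric makes them discrete
metrics. The word `powerCommutator n` has length at most `4 * 16 ^ n`. Level `n` gives it the value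
`2 * 16 ^ n`, every other level at most `16 ^ n / 2`, so it tells whether `n ∈ A`.

If all these metrics embedded in one separable group, two of them would have nearly equal images of
the generators, by pigeonhole on a dense sequence. Bi-invariance spreads this closeness to all words
in proportion to length, which contradicts the separation. -/

open Metric in
/-- Left translations of the group of unit elements of a normed division ring are isometries. -/
instance unitSphere_isIsometricSMul {𝕜 : Type*} [NormedDivisionRing 𝕜] :
    IsIsometricSMul (sphere (0 : 𝕜) 1) (sphere (0 : 𝕜) 1) :=
  ⟨fun g => Isometry.of_dist_eq fun x y => by
    rw [Subtype.dist_eq, Subtype.dist_eq, smul_eq_mul, smul_eq_mul, Metric.unitSphere.coe_mul,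
      Metric.unitSphere.coe_mul, dist_eq_norm, dist_eq_norm, ← mul_sub, norm_mul,
      norm_eq_of_mem_sphere, one_mul]⟩

open Metric in
/-- Right translations of the group of unit elements of a normed division ring are isometries. -/
instance unitSphere_isIsometricSMul_op {𝕜 : Type*} [NormedDivisionRing 𝕜] :
    IsIsometricSMul (sphere (0 : 𝕜) 1)ᵐᵒᵖ (sphere (0 : 𝕜) 1) :=
  ⟨fun g => Isometry.of_dist_eq fun x y => by
    rw [Subtype.dist_eq, Subtype.dist_eq, MulOpposite.smul_eq_mul_unop,
      MulOpposite.smul_eq_mul_unop, Metric.unitSphere.coe_mul,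
      Metric.unitSphere.coe_mul, dist_eq_norm, dist_eq_norm, ← sub_mul, norm_mul,
      norm_eq_of_mem_sphere, mul_one]⟩

section FreeGroupHoms

variable {α : Type*} [DecidableEq α] {G : Type*} [Group G] [MetricSpace G]
  [IsIsometricSMul G G] [IsIsometricSMul Gᵐᵒᵖ G]

theorem dist_mul_mul_le_add (a b c d : G) : dist (a * c) (b * d) ≤ dist a b + dist c d := by
  calc dist (a * c) (b * d) ≤ dist (a * c) (b * c) + dist (b * c) (b * d) := dist_triangle _ _ _
    _ = dist a b + dist c d := by rw [dist_mul_right, dist_mul_left]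

theorem dist_inv_inv_eq (a b : G) : dist a⁻¹ b⁻¹ = dist a b := by
  rw [← dist_mul_left a, ← dist_mul_right _ _ b]
  simp [dist_comm]

/-- Homomorphisms from a free group to a group with bi-invariant metric that are close on the
generators are close relative to the word length. -/
theorem FreeGroup.dist_hom_le (φ ψ : FreeGroup α →* G) {C : ℝ}
    (h : ∀ i, dist (φ (.of i)) (ψ (.of i)) ≤ C) (g : FreeGroup α) :
    dist (φ g) (ψ g) ≤ C * g.norm := by
  have key : ∀ L : List (α × Bool), dist (φ (.mk L)) (ψ (.mk L)) ≤ C * L.length := by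
    intro L
    induction L with
    | nil =>
      change dist (φ 1) (ψ 1) ≤ _
      simp
    | cons x L ih =>
      have hx : dist (φ (.mk [x])) (ψ (.mk [x])) ≤ C := by
        obtain ⟨i, b⟩ := x
        cases b with
        | true => exact h i
        | false =>
          have : (FreeGroup.mk [(i, false)] : FreeGroup α) = (FreeGroup.of i)⁻¹ := rfl
          rw [this, _root_.map_inv, _root_.map_inv, dist_inv_inv_eq]
          exact h i
      have e : (FreeGroup.mk (x :: L) : FreeGroup α) = .mk [x] * .mk L := by
        rw [FreeGroup.mul_mk]; rfl
      rw [e, _root_.map_mul, _root_.map_mul]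
      refine (dist_mul_mul_le_add _ _ _ _).trans ?_
      push_cast [List.length_cons]
      linarith
  have := key g.toWord
  rwa [FreeGroup.mk_toWord] at this

end FreeGroupHoms

/-! ### Small rotations in the unit quaternions -/

section Quaternions

open Metric Quaternion Real

/-- The quaternion with given coordinates. -/
def quaternionOf (a b c d : ℝ) : ℍ[ℝ] := ⟨a, b, c, d⟩

@[simp] theorem re_quaternionOf (a b c d : ℝ) : (quaternionOf a b c d).re = a := rfl

@[simp] theorem imI_quaternionOf (a b c d : ℝ) : (quaternionOf a b c d).imI = b := rfl

@[simp] theorem imJ_quaternionOf (a b c d : ℝ) : (quaternionOf a b c d).imJ = c := rfl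

@[simp] theorem imK_quaternionOf (a b c d : ℝ) : (quaternionOf a b c d).imK = d := rfl

/-- The unit quaternion `exp (θ i)`. -/
noncomputable def expI (θ : ℝ) : sphere (0 : ℍ[ℝ]) 1 :=
  ⟨quaternionOf (cos θ) (sin θ) 0 0, by
    rw [mem_sphere_zero_iff_norm, ← pow_eq_one_iff_of_nonneg (norm_nonneg _) two_ne_zero, sq,
      ← normSq_eq_norm_mul_self, normSq_def']
    simp⟩

/-- The unit quaternion `exp (θ j)`. -/
noncomputable def expJ (θ : ℝ) : sphere (0 : ℍ[ℝ]) 1 :=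
  ⟨quaternionOf (cos θ) 0 (sin θ) 0, by
    rw [mem_sphere_zero_iff_norm, ← pow_eq_one_iff_of_nonneg (norm_nonneg _) two_ne_zero, sq,
      ← normSq_eq_norm_mul_self, normSq_def']
    simp⟩

theorem expI_add (θ η : ℝ) : expI (θ + η) = expI θ * expI η := by
  ext
  all_goals simp [expI, cos_add, sin_add]
  ring

theorem expJ_add (θ η : ℝ) : expJ (θ + η) = expJ θ * expJ η := by
  ext
  all_goals simp [expJ, cos_add, sin_add]
  ring

theorem expI_zero : expI 0 = 1 := by
  ext
  all_goals simp [expI]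

theorem expJ_zero : expJ 0 = 1 := by
  ext
  all_goals simp [expJ]

theorem expI_pow (θ : ℝ) (k : ℕ) : expI θ ^ k = expI (k * θ) := by
  induction k with
  | zero => simp [expI_zero]
  | succ k ih => rw [pow_succ, ih, ← expI_add]; push_cast; ring_nf

theorem expJ_pow (θ : ℝ) (k : ℕ) : expJ θ ^ k = expJ (k * θ) := by
  induction k with
  | zero => simp [expJ_zero]
  | succ k ih => rw [pow_succ, ih, ← expJ_add]; push_cast; ring_nf

theorem dist_expI_one_le (θ : ℝ) : dist (expI θ) 1 ≤ |θ| := by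
  rw [Subtype.dist_eq, dist_eq_norm]
  refine abs_le_of_sq_le_sq' ?_ (abs_nonneg _) |>.2
  rw [sq, ← normSq_eq_norm_mul_self, normSq_def', sq_abs]
  simp [expI]
  nlinarith [one_sub_sq_div_two_le_cos (x := θ), sin_sq_add_cos_sq θ]

theorem dist_expJ_one_le (θ : ℝ) : dist (expJ θ) 1 ≤ |θ| := by
  rw [Subtype.dist_eq, dist_eq_norm]
  refine abs_le_of_sq_le_sq' ?_ (abs_nonneg _) |>.2
  rw [sq, ← normSq_eq_norm_mul_self, normSq_def', sq_abs]
  simp [expJ]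
  nlinarith [one_sub_sq_div_two_le_cos (x := θ), sin_sq_add_cos_sq θ]

/-- The commutator is as far from `1` as `xy` from `yx`, and `xy - yx = sin² θ (ij - ji) = 2 sin² θ
k`. -/
theorem dist_commutator_expI_expJ (θ : ℝ) :
    dist (expI θ * expJ θ * (expI θ)⁻¹ * (expJ θ)⁻¹) 1 = 2 * sin θ ^ 2 := by
  have : dist (expI θ * expJ θ * (expI θ)⁻¹ * (expJ θ)⁻¹) 1 = dist (expI θ * expJ θ) (expJ θ * expI θ) := by
    rw [← dist_mul_right _ _ (expJ θ * expI θ)]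
    simp [mul_assoc]
  rw [this, Subtype.dist_eq, dist_eq_norm]
  rw [← pow_left_inj₀ (norm_nonneg _) (by positivity) two_ne_zero,
    sq, ← normSq_eq_norm_mul_self, normSq_def']
  simp [expI, expJ]
  ring

/-- The homomorphism from `F_3` to the unit quaternions that sends the first two generators to
rotations by the angle `π / (2 * 16 ^ n)` about orthogonal axes, and the third one to `1`. -/
noncomputable def quaternionHom (n : ℕ) : FreeGroup (Fin 3) →* sphere (0 : ℍ[ℝ]) 1 :=
  FreeGroup.lift ![expI (π / 2 / 16 ^ n), expJ (π / 2 / 16 ^ n), 1]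

theorem dist_quaternionHom_one_le (n : ℕ) (g : FreeGroup (Fin 3)) :
    16 ^ n * dist (quaternionHom n g) 1 ≤ 2 * g.norm := by
  have h : dist (quaternionHom n g) ((1 : FreeGroup (Fin 3) →* sphere (0 : ℍ[ℝ]) 1) g)
      ≤ (2 / 16 ^ n) * g.norm := by
    refine FreeGroup.dist_hom_le _ _ (fun i => ?_) g
    have hθ : |π / 2 / 16 ^ n| ≤ 2 / 16 ^ n := by
      rw [abs_of_pos (by positivity)]
      gcongr
      linarith [pi_le_four]
    fin_cases i
    · simpa [quaternionHom] using (dist_expI_one_le _).trans hθ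
    · simpa [quaternionHom] using (dist_expJ_one_le _).trans hθ
    · simpa [quaternionHom] using (abs_nonneg _).trans hθ
  rw [MonoidHom.one_apply] at h
  calc 16 ^ n * dist (quaternionHom n g) 1 ≤ 16 ^ n * ((2 / 16 ^ n) * g.norm) := by gcongr
    _ = 2 * g.norm := by field_simp

/-- The commutator of the `16 ^ n`-th powers of the first two generators of `F_3`. -/
def powerCommutator (n : ℕ) : FreeGroup (Fin 3) :=
  .of 0 ^ 16 ^ n * .of 1 ^ 16 ^ n * (.of 0 ^ 16 ^ n)⁻¹ * (.of 1 ^ 16 ^ n)⁻¹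

theorem norm_powerCommutator_le (n : ℕ) : (powerCommutator n).norm ≤ 4 * 16 ^ n := by
  have h1 := FreeGroup.norm_of_pow (0 : Fin 3) (16 ^ n)
  have h2 := FreeGroup.norm_of_pow (1 : Fin 3) (16 ^ n)
  rw [powerCommutator]
  grw [FreeGroup.norm_mul_le, FreeGroup.norm_mul_le, FreeGroup.norm_mul_le,
    FreeGroup.norm_inv_eq, FreeGroup.norm_inv_eq, h1, h2]
  omega

theorem dist_quaternionHom_powerCommutator (m n : ℕ) :
    dist (quaternionHom m (powerCommutator n)) 1 = 2 * sin (16 ^ n * (π / 2 / 16 ^ m)) ^ 2 := by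
  have : quaternionHom m (powerCommutator n) =
      expI (16 ^ n * (π / 2 / 16 ^ m)) * expJ (16 ^ n * (π / 2 / 16 ^ m)) *
        (expI (16 ^ n * (π / 2 / 16 ^ m)))⁻¹ * (expJ (16 ^ n * (π / 2 / 16 ^ m)))⁻¹ := by
    simp [powerCommutator, quaternionHom, expI_pow, expJ_pow]
  rw [this, dist_commutator_expI_expJ]

theorem dist_quaternionHom_powerCommutator_self (n : ℕ) :
    16 ^ n * dist (quaternionHom n (powerCommutator n)) 1 = 2 * 16 ^ n := by
  have : (16 : ℝ) ^ n * (π / 2 / 16 ^ n) = π / 2 := by field_simp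
  rw [dist_quaternionHom_powerCommutator, this, sin_pi_div_two]
  ring

/-- For `m < n` the scale `16 ^ m` is itself small; for `m > n` the commutator is quadratic in the
angle, which beats the linear scaling. -/
theorem dist_quaternionHom_powerCommutator_le {m n : ℕ} (h : m ≠ n) :
    16 ^ m * dist (quaternionHom m (powerCommutator n)) 1 ≤ 16 ^ n / 2 := by
  rw [dist_quaternionHom_powerCommutator]
  rcases h.lt_or_gt with h | h
  · have h1 : (16 : ℝ) ^ m * 16 ≤ 16 ^ n := by
      rw [← pow_succ]; exact pow_le_pow_right₀ (by norm_num) h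
    nlinarith [sin_sq_le_one (16 ^ n * (π / 2 / 16 ^ m)), pow_pos (by norm_num : (0 : ℝ) < 16) m]
  · have h1 : (16 : ℝ) ^ n * 16 ≤ 16 ^ m := by
      rw [← pow_succ]; exact pow_le_pow_right₀ (by norm_num) h
    have hm : (0 : ℝ) < 16 ^ m := by positivity
    have hn : (0 : ℝ) < 16 ^ n := by positivity
    have hs : sin (16 ^ n * (π / 2 / 16 ^ m)) ^ 2 ≤ (16 ^ n * (π / 2 / 16 ^ m)) ^ 2 := by
      rw [sq_le_sq]; exact abs_sin_le_abs
    have hπ : π ^ 2 ≤ 16 := by nlinarith [pi_le_four, pi_pos]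
    calc (16 : ℝ) ^ m * (2 * sin (16 ^ n * (π / 2 / 16 ^ m)) ^ 2)
        ≤ 16 ^ m * (2 * (16 ^ n * (π / 2 / 16 ^ m)) ^ 2) := by gcongr
      _ = π ^ 2 / 2 * 16 ^ n * (16 ^ n / 16 ^ m) := by field_simp
      _ ≤ 8 * 16 ^ n * (1 / 16) :=
        mul_le_mul (by gcongr; linarith) (by rw [div_le_iff₀ hm]; linarith) (by positivity)
          (by positivity)
      _ = 16 ^ n / 2 := by ring

end Quaternions

/-! ### The metrics indexed by subsets of `ℕ` -/

section Family

/-- The scaled pseudometric pulled back along `quaternionHom n` if `n ∈ A`, and `0` otherwise. -/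
noncomputable def pullbackDist (A : Set ℕ) (n : ℕ) (x y : FreeGroup (Fin 3)) : ℝ :=
  A.indicator (fun n => 16 ^ n * dist (quaternionHom n x) (quaternionHom n y)) n

theorem pullbackDist_nonneg (A : Set ℕ) (n : ℕ) (x y : FreeGroup (Fin 3)) :
    0 ≤ pullbackDist A n x y :=
  Set.indicator_nonneg (fun _ _ => by positivity) _

theorem pullbackDist_le (A : Set ℕ) (n : ℕ) (x y : FreeGroup (Fin 3)) :
    pullbackDist A n x y ≤ 2 * (x * y⁻¹).norm := by
  refine (Set.indicator_le_self' (fun _ _ => by positivity) n).trans ?_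
  refine le_trans (le_of_eq ?_) (dist_quaternionHom_one_le n (x * y⁻¹))
  rw [← dist_mul_right (quaternionHom n x) (quaternionHom n y) (quaternionHom n y)⁻¹]
  simp

theorem bddAbove_pullbackDist (A : Set ℕ) (x y : FreeGroup (Fin 3)) :
    BddAbove (Set.range fun n => pullbackDist A n x y) :=
  ⟨2 * (x * y⁻¹).norm, by rintro _ ⟨n, rfl⟩; exact pullbackDist_le A n x y⟩

theorem iSup_pullbackDist_nonneg (A : Set ℕ) (x y : FreeGroup (Fin 3)) :
    0 ≤ ⨆ n, pullbackDist A n x y :=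
  Real.iSup_nonneg fun n => pullbackDist_nonneg A n x y

/-- The discrete bi-invariant metric on `F_3` that combines the metrics pulled back along
`quaternionHom n` for `n ∈ A`. -/
noncomputable def quaternionMetric (A : Set ℕ) : BiInvariantMetric (FreeGroup (Fin 3)) where
  toFun x y := (if x = y then 0 else 1) + ⨆ n, pullbackDist A n x y
  self_eq_zero x := by simp [pullbackDist]
  comm x y := by simp [pullbackDist, dist_comm, eq_comm]
  triangle x y z := by
    have h1 : (if x = z then 0 else 1 : ℝ) ≤
        (if x = y then 0 else 1) + (if y = z then 0 else 1) := by
      split_ifs <;> simp_all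
    have h2 : ⨆ n, pullbackDist A n x z ≤
        (⨆ n, pullbackDist A n x y) + ⨆ n, pullbackDist A n y z := by
      refine ciSup_le fun n => ?_
      refine le_trans ?_ (add_le_add (le_ciSup (bddAbove_pullbackDist A x y) n)
        (le_ciSup (bddAbove_pullbackDist A y z) n))
      simp only [pullbackDist]
      rw [← Pi.add_apply (A.indicator _), ← Set.indicator_add']
      refine Set.indicator_le_indicator ?_
      rw [Pi.add_apply, ← mul_add]
      gcongr
      exact dist_triangle _ _ _
    linarith
  eq_of_eq_zero x y h := by
    by_contra hne
    have := iSup_pullbackDist_nonneg A x y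
    rw [if_neg hne] at h
    linarith
  mul_left g x y := by simp [pullbackDist]
  mul_right g x y := by simp [pullbackDist]

theorem abs_quaternionMetric_sub_le (A B : Set ℕ) (g : FreeGroup (Fin 3)) :
    |(quaternionMetric A).toFun g 1 - (quaternionMetric B).toFun g 1| ≤ 2 * (g.norm : ℝ) := by
  have h : ∀ A, ⨆ n, pullbackDist A n g 1 ≤ 2 * (g.norm : ℝ) := fun A =>
    ciSup_le fun n => by simpa using pullbackDist_le A n g 1
  have hA := iSup_pullbackDist_nonneg A g 1
  have hB := iSup_pullbackDist_nonneg B g 1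
  simp only [quaternionMetric]
  rw [add_sub_add_left_eq_sub, abs_le]
  constructor <;> linarith [h A, h B]

theorem le_quaternionMetric_sub {A B : Set ℕ} {n : ℕ} (hA : n ∈ A) (hB : n ∉ B) :
    3 / 2 * 16 ^ n ≤ (quaternionMetric A).toFun (powerCommutator n) 1 -
      (quaternionMetric B).toFun (powerCommutator n) 1 := by
  have h1 : 2 * 16 ^ n ≤ ⨆ m, pullbackDist A m (powerCommutator n) 1 := by
    refine le_trans (le_of_eq ?_) (le_ciSup (bddAbove_pullbackDist A _ _) n)
    simp [pullbackDist, hA, dist_quaternionHom_powerCommutator_self]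
  have h2 : ⨆ m, pullbackDist B m (powerCommutator n) 1 ≤ 16 ^ n / 2 := by
    refine ciSup_le fun m => ?_
    simp only [pullbackDist]
    refine Set.indicator_apply_le' (fun hm => ?_) (fun _ => by positivity)
    rw [map_one]
    exact dist_quaternionHom_powerCommutator_le (ne_of_mem_of_not_mem hm hB)
  simp only [quaternionMetric]
  linarith

theorem lt_freeDist_quaternionMetric {A B : Set ℕ} (h : A ≠ B) :
    1 / 4 < BiInvariantMetric.freeDist (quaternionMetric A) (quaternionMetric B) := by
  obtain ⟨n, hn⟩ : ∃ n, 3 / 2 * 16 ^ n ≤ |(quaternionMetric A).toFun (powerCommutator n) 1 -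
      (quaternionMetric B).toFun (powerCommutator n) 1| := by
    obtain ⟨n, ⟨hA, hB⟩ | ⟨hB, hA⟩⟩ := Set.symmDiff_nonempty.2 h
    · exact ⟨n, (le_quaternionMetric_sub hA hB).trans (le_abs_self _)⟩
    · exact ⟨n, (le_quaternionMetric_sub hB hA).trans ((le_abs_self _).trans_eq (abs_sub_comm _ _))⟩
  -- A gap of `3 / 2 * 16 ^ n` on a word of length at most `4 * 16 ^ n` gives `3 / 8`. The set of
  -- admissible `ε` must be nonempty, since `sInf ∅ = 0`.
  refine lt_of_lt_of_le (by norm_num : (1 / 4 : ℝ) < 3 / 8) (le_csInf ?_ ?_)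
  · exact ⟨2, two_pos, fun g => abs_quaternionMetric_sub_le A B g⟩
  · rintro ε ⟨hε, hle⟩
    have h1 := hn.trans (hle (powerCommutator n))
    have h2 : ((powerCommutator n).norm : ℝ) ≤ 4 * 16 ^ n := by
      exact_mod_cast norm_powerCommutator_le n
    have h3 : ε * ((powerCommutator n).norm : ℝ) ≤ ε * (4 * 16 ^ n) := by gcongr
    have h4 : (0 : ℝ) < 16 ^ n := by positivity
    by_contra! hlt
    have : 3 / 2 * (16 : ℝ) ^ n ≤ ε * (4 * 16 ^ n) := h1.trans h3
    nlinarith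

theorem quaternionMetric_injective : Function.Injective quaternionMetric := by
  intro A B hAB
  by_contra h
  wlog hn : ∃ n, n ∈ A ∧ n ∉ B generalizing A B
  · obtain ⟨n, ⟨hA, hB⟩ | ⟨hB, hA⟩⟩ := Set.symmDiff_nonempty.2 h
    · exact hn ⟨n, hA, hB⟩
    · exact this hAB.symm (Ne.symm h) ⟨n, hB, hA⟩
  obtain ⟨n, hA, hB⟩ := hn
  have h1 := le_quaternionMetric_sub hA hB
  have h2 : (0 : ℝ) < 16 ^ n := by positivity
  rw [hAB, sub_self] at h1
  linarith

theorem discreteTopology_quaternionMetric (A : Set ℕ) :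
    DiscreteTopology (WithBiInvariantMetric (quaternionMetric A)) := by
  refine DiscreteTopology.of_forall_le_dist one_pos fun x y hne => ?_
  have e : dist x y = 1 + ⨆ n, pullbackDist A n x y :=
    congrArg (· + ⨆ n, pullbackDist A n x y) (if_neg hne)
  change 1 ≤ dist x y
  rw [e]
  linarith [iSup_pullbackDist_nonneg A x y]

theorem separableSpace_quaternionMetric (A : Set ℕ) :
    TopologicalSpace.SeparableSpace (WithBiInvariantMetric (quaternionMetric A)) :=
  have : Countable (WithBiInvariantMetric (quaternionMetric A)) :=
    inferInstanceAs (Countable (FreeGroup (Fin 3)))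
  inferInstance

end Family

/-! ### Separable groups and non-embedding -/

/-- The identity map from `G` to the metric group `(G, d)`. -/
def WithBiInvariantMetric.mulEquiv {G : Type*} [Group G] (d : BiInvariantMetric G) :
    G ≃* WithBiInvariantMetric d :=
  MulEquiv.refl G

theorem WithBiInvariantMetric.dist_mulEquiv {G : Type*} [Group G] (d : BiInvariantMetric G)
    (x y : G) : dist (mulEquiv d x) (mulEquiv d y) = d.toFun x y :=
  rfl

/-- If two metrics on a free group of finite rank embed isometrically into the same group in such a
way that the images of the generators are close, then the metrics are close. -/
theorem BiInvariantMetric.freeDist_le_of_dist_le {n : ℕ} {G : Type*} [Group G] [MetricSpace G]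
    [IsIsometricSMul G G] [IsIsometricSMul Gᵐᵒᵖ G] {d p : BiInvariantMetric (FreeGroup (Fin n))}
    {φ : WithBiInvariantMetric d →* G} {ψ : WithBiInvariantMetric p →* G}
    (hφ : Isometry φ) (hψ : Isometry ψ) {ε : ℝ} (hε : 0 < ε)
    (h : ∀ i : Fin n, dist (φ (WithBiInvariantMetric.mulEquiv d (.of i)))
      (ψ (WithBiInvariantMetric.mulEquiv p (.of i))) ≤ ε) :
    BiInvariantMetric.freeDist d p ≤ ε := by
  refine csInf_le ⟨0, fun _ hx => hx.1.le⟩ ⟨hε, fun g => ?_⟩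
  rw [← WithBiInvariantMetric.dist_mulEquiv d, ← WithBiInvariantMetric.dist_mulEquiv p,
    ← hφ.dist_eq, ← hψ.dist_eq]
  simp only [map_one]
  exact (abs_dist_sub_le _ _ _).trans (FreeGroup.dist_hom_le
    (φ.comp (WithBiInvariantMetric.mulEquiv d).toMonoidHom)
    (ψ.comp (WithBiInvariantMetric.mulEquiv p).toMonoidHom) h g)

theorem exists_quaternionMetric_not_embedsIsometrically (G : Type*) [Group G] [MetricSpace G]
    [IsIsometricSMul G G] [IsIsometricSMul Gᵐᵒᵖ G] [TopologicalSpace.SeparableSpace G] :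
    ∃ A : Set ℕ, ¬ EmbedsIsometrically (WithBiInvariantMetric (quaternionMetric A)) G := by
  by_contra! hcon
  choose φ hφ using hcon
  -- Two points within `1 / 8` of the same dense point are within `1 / 4`, the separation constant.
  have happ : ∀ (A : Set ℕ) (i : Fin 3), ∃ k : ℕ,
      dist (φ A (WithBiInvariantMetric.mulEquiv _ (.of i))) (TopologicalSpace.denseSeq G k) < 1 / 8 :=
    fun A i =>
       (TopologicalSpace.denseRange_denseSeq G).exists_dist_lt _ (by norm_num)
  choose k hk using happ
  obtain ⟨A, B, hAB, hne⟩ : ∃ A B, k A = k B ∧ A ≠ B := by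
    by_contra! hinj
    have : Function.Injective k := fun A B => hinj A B
    -- `Fin 3 → ℕ` is countable, `Set ℕ` is not.
    exact (Cardinal.aleph0_lt_mk_iff.1 (by simpa using Cardinal.cantor Cardinal.aleph0)).not_countable
      this.countable
  refine (lt_freeDist_quaternionMetric hne).not_ge
    (BiInvariantMetric.freeDist_le_of_dist_le (hφ A) (hφ B) (by norm_num) fun i => ?_)
  have hA := hk A i
  have hB := hk B i
  rw [← hAB, dist_comm] at hB
  linarith [dist_triangle (φ A (WithBiInvariantMetric.mulEquiv _ (.of i)))
    (TopologicalSpace.denseSeq G (k A i)) (φ B (WithBiInvariantMetric.mulEquiv _ (.of i)))]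

/-- Right translations are isometries on the lift of a group with bi-invariant metric. -/
instance ulift_isIsometricSMul_op {H : Type*} [Group H] [MetricSpace H]
    [IsIsometricSMul Hᵐᵒᵖ H] : IsIsometricSMul (ULift H)ᵐᵒᵖ (ULift H) :=
  ⟨fun g => Isometry.of_dist_eq fun x y => dist_mul_right x.down y.down g.unop.down⟩

theorem embedsIsometrically_of_uLift {H : Type*} {G : Type*} [Group H] [MetricSpace H]
    [Group G] [MetricSpace G] (h : EmbedsIsometrically (ULift H) G) :
    EmbedsIsometrically H G := by
  obtain ⟨f, hf⟩ := h
  exact ⟨f.comp MulEquiv.ulift.symm.toMonoidHom, Isometry.of_dist_eq fun x y => hf.dist_eq _ _⟩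

theorem mainTheorem3 :
    -- continuum many discrete bi-invariant metrics on the free group of rank 3, uniformly far apart
    (∃ K : ℝ, 0 < K ∧ ∃ D : Set (BiInvariantMetric (FreeGroup (Fin 3))),
      Cardinal.mk D = Cardinal.continuum ∧
      (∀ d ∈ D, DiscreteTopology (WithBiInvariantMetric d)) ∧
      (∀ d ∈ D, ∀ p ∈ D, d ≠ p → K < BiInvariantMetric.freeDist d p)) ∧
    -- every separable metric group omits some discrete bi-invariant metric on it
    (∀ (G : Type u) [Group G] [MetricSpace G] [IsIsometricSMul G G] [IsIsometricSMul Gᵐᵒᵖ G]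
      [TopologicalSpace.SeparableSpace G],
      ∃ d : BiInvariantMetric (FreeGroup (Fin 3)),
        DiscreteTopology (WithBiInvariantMetric d) ∧
        LocallyCompactSpace (WithBiInvariantMetric d) ∧
        TopologicalSpace.SeparableSpace (WithBiInvariantMetric d) ∧
        ¬ EmbedsIsometrically (WithBiInvariantMetric d) G) ∧
    -- no metrically universal separable group with bi-invariant metric
    (¬ ∃ (G : Type u) (_ : Group G) (_ : MetricSpace G) (_ : IsIsometricSMul G G)
      (_ : IsIsometricSMul Gᵐᵒᵖ G) (_ : TopologicalSpace.SeparableSpace G),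
      ∀ (H : Type v) [Group H] [MetricSpace H] [IsIsometricSMul H H] [IsIsometricSMul Hᵐᵒᵖ H]
        [TopologicalSpace.SeparableSpace H], EmbedsIsometrically H G) ∧
    -- no metrically universal locally compact separable group with bi-invariant metric
    (¬ ∃ (G : Type u) (_ : Group G) (_ : MetricSpace G) (_ : IsIsometricSMul G G)
      (_ : IsIsometricSMul Gᵐᵒᵖ G) (_ : TopologicalSpace.SeparableSpace G)
      (_ : LocallyCompactSpace G),
      ∀ (H : Type v) [Group H] [MetricSpace H] [IsIsometricSMul H H] [IsIsometricSMul Hᵐᵒᵖ H]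
        [TopologicalSpace.SeparableSpace H] [LocallyCompactSpace H],
        EmbedsIsometrically H G) := by

  refine ⟨⟨1 / 4, by norm_num, Set.range quaternionMetric, ?_, ?_, ?_⟩, ?_, ?_, ?_⟩
  · rw [Cardinal.mk_range_eq _ quaternionMetric_injective]
    simp
  · rintro _ ⟨A, rfl⟩
    exact discreteTopology_quaternionMetric A
  · rintro _ ⟨A, rfl⟩ _ ⟨B, rfl⟩ hne
    exact lt_freeDist_quaternionMetric fun h => hne (congrArg _ h)
  · intro G _ _ _ _ _
    obtain ⟨A, hA⟩ := exists_quaternionMetric_not_embedsIsometrically G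
    have := discreteTopology_quaternionMetric A
    exact ⟨quaternionMetric A, this, inferInstance, separableSpace_quaternionMetric A, hA⟩
  · rintro ⟨G, _, _, _, _, _, h⟩
    obtain ⟨A, hA⟩ := exists_quaternionMetric_not_embedsIsometrically G
    have := discreteTopology_quaternionMetric A
    have := separableSpace_quaternionMetric A
    -- The lift moves the countable group into the universe `v` of the test groups.
    have : TopologicalSpace.SeparableSpace
        (ULift.{v} (WithBiInvariantMetric (quaternionMetric A))) :=
      Homeomorph.ulift.symm.surjective.denseRange.separableSpace Homeomorph.ulift.symm.continuous
    exact hA (embedsIsometrically_of_uLift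
      (h (ULift.{v} (WithBiInvariantMetric (quaternionMetric A)))))
  · rintro ⟨G, _, _, _, _, _, _, h⟩
    obtain ⟨A, hA⟩ := exists_quaternionMetric_not_embedsIsometrically G
    have := discreteTopology_quaternionMetric A
    have := separableSpace_quaternionMetric A
    have : TopologicalSpace.SeparableSpace
        (ULift.{v} (WithBiInvariantMetric (quaternionMetric A))) :=
      Homeomorph.ulift.symm.surjective.denseRange.separableSpace Homeomorph.ulift.symm.continuous
    exact hA (embedsIsometrically_of_uLift
      (h (ULift.{v} (WithBiInvariantMetric (quaternionMetric A)))))
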